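/- All spaces are real. A Banach space $X$ is \emph{extremely non-complex} if $\|\mathrm{Id}+T^2\|=1+\|T^2\|$ for every bounded linear operator $T$ on $X$; $\mathrm{Iso}(X)$ denotes the group, under composition, of surjective linear isometries of $X$; and $\mathrm{Unc}(X)$ denotes the set of unconditional projections on $X$, i.e. the bounded linear operators $P$ on $X$ with $P^2=P$ and $2P-\mathrm{Id}\in\mathrm{Iso}(X)$. Let $K$ be a perfect compact Hausdorff space (that is, without isolated points) such that the space $C(K)$ of real-valued continuous functions on $K$, with the supremum norm, is extremely non-complex. (1) For every $T\in\mathrm{Iso}(C(K))$ there is a continuous function $\theta:K\to\{-1,1\}$ such that $T(f)=\theta f$ for all $f\in C(K)$. (2) Conversely, for every continuous $\theta:K\to\{-1,1\}$, the operator $T(f)=\theta f$ $(f\in C(K))$ belongs to $\mathrm{Iso}(C(K))$. (3) Hence $\mathrm{Iso}(C(K))$ is isomorphic to the Boolean algebra $\mathrm{Clop}(K)$ of clopen subsets of $K$, in the following sense. The map $\Phi$ sending a clopen set $A$ to the operator of multiplication by the function equal to $-1$ on $A$ and $1$ on $K\setminus A$ is a group isomorphism from $(\mathrm{Clop}(K),\triangle)$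 onto $\mathrm{Iso}(C(K))$. The map $\Psi(A)=\frac12(\mathrm{Id}-\Phi(A))$ is a bijection from $\mathrm{Clop}(K)$ onto $\mathrm{Unc}(C(K))$ that carries the Boolean operations to those of commuting projections: $\Psi(\emptyset)=0$, $\Psi(K)=\mathrm{Id}$, $\Psi(K\setminus A)=\mathrm{Id}-\Psi(A)$, $\Psi(A\cap B)=\Psi(A)\Psi(B)$ and $\Psi(A\cup B)=\Psi(A)+\Psi(B)-\Psi(A)\Psi(B)$. -/

import Mathlib

/-- A real Banach space `X` is extremely non-complex if `‖Id + T²‖ = 1 + ‖T²‖` for every bounded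
linear operator `T` on `X` (the product of operators is composition). -/
def ExtremelyNonComplex (X : Type*) [NormedAddCommGroup X] [NormedSpace ℝ X] : Prop :=
  ∀ T : X →L[ℝ] X, ‖(1 : X →L[ℝ] X) + T ^ 2‖ = 1 + ‖T ^ 2‖

/-- The set of unconditional projections on `X`: the idempotent bounded operators `P` for which
`2P - Id` is a surjective linear isometry. -/
def unconditionalProjections (X : Type*) [NormedAddCommGroup X] [NormedSpace ℝ X] :
    Set (X →L[ℝ] X) :=
  {P | P * P = P ∧ ∃ T : X ≃ₗᵢ[ℝ] X, ∀ x, T x = (2 : ℝ) • P x - x}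

open TopologicalSpace

/-! In an extremely non-complex space, `‖Id + S²‖ ≤ 1` forces `S² = 0`. Taking `S = (T - T⁻¹)/√2`
for an isometry `T` gives `T² + T⁻² = 2 Id`, so `N = T² - Id` has square zero and `T²ⁿ = Id + nN`;
boundedness of the powers makes `N = 0`, and every isometry is an involution.

On `C(K)`, `T 1` is unimodular, and multiplying by it reduces to an isometry `U` with `U 1 = 1`.
Such a `U` is positive, hence a composition operator, hence multiplicative. For `h = g - U g` one
has `U h = -h`, so `S f = h · U f` satisfies `S² f = -h² f`. When `‖h‖ ≤ 1` the first principle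
gives `h² = 0`, so `U` is the identity. Thus isometries are multiplications by sign functions, that
is, by clopen sets, and unconditional projections are multiplications by their indicators. -/

/-- If `1 + n • N` stays in the unit ball for all `n`, then `N = 0`. -/
theorem eq_zero_of_norm_one_add_nsmul_le {E : Type*} [NormedAddCommGroup E] [NormedSpace ℝ E]
    {a N : E} (h : ∀ n : ℕ, ‖a + (n : ℝ) • N‖ ≤ 1) : N = 0 := by
  by_contra hN
  have hpos : 0 < ‖N‖ := norm_pos_iff.2 hN
  obtain ⟨n, hn⟩ := exists_nat_gt (2 / ‖N‖)
  rw [div_lt_iff₀ hpos] at hn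
  have h0 := h 0
  have h1 := norm_sub_le (a + (n : ℝ) • N) a
  simp only [Nat.cast_zero, zero_smul, add_zero] at h0
  rw [add_sub_cancel_left, norm_smul, Real.norm_natCast] at h1
  linarith [h n]

/-! ### Isometries of extremely non-complex spaces -/

namespace ExtremelyNonComplex

variable {X : Type*} [NormedAddCommGroup X] [NormedSpace ℝ X]

theorem sq_eq_zero (hX : ExtremelyNonComplex X) {S : X →L[ℝ] X}
    (hS : ‖(1 : X →L[ℝ] X) + S ^ 2‖ ≤ 1) : S ^ 2 = 0 := by
  have h := hX S
  exact norm_le_zero_iff.1 (by linarith)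

/-- Surjective isometries of an extremely non-complex space are involutions. -/
theorem apply_apply_isometry (hX : ExtremelyNonComplex X) (T : X ≃ₗᵢ[ℝ] X) (x : X) :
    T (T x) = x := by
  set A : X →L[ℝ] X := T.toLinearIsometry.toContinuousLinearMap with hA
  set B : X →L[ℝ] X := T.symm.toLinearIsometry.toContinuousLinearMap with hB
  have hAB : A * B = 1 := by ext y; simp [hA, hB]
  have hBA : B * A = 1 := by ext y; simp [hA, hB]
  have hnA : ‖A‖ ≤ 1 := T.toLinearIsometry.norm_toContinuousLinearMap_le
  have hnB : ‖B‖ ≤ 1 := T.symm.toLinearIsometry.norm_toContinuousLinearMap_le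
  have hpow : ∀ {C : X →L[ℝ] X}, ‖C‖ ≤ 1 → ∀ n : ℕ, ‖C ^ n‖ ≤ 1 := by
    intro C hC n
    induction n with
    | zero => exact ContinuousLinearMap.norm_id_le
    | succ n ih =>
      rw [pow_succ]
      exact (norm_mul_le _ _).trans (mul_le_one₀ ih (norm_nonneg _) hC)
  -- The factor `1/√2` makes the cross terms equal exactly `-Id`, leaving `Id + S²` as the average
  -- of two contractions.
  have hsq : ((Real.sqrt 2)⁻¹ • (A - B)) ^ 2 = (1 / 2 : ℝ) • (A ^ 2 + B ^ 2) - 1 := by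
    rw [smul_pow, inv_pow, Real.sq_sqrt zero_le_two]
    have : (A - B) ^ 2 = A ^ 2 + B ^ 2 - (2 : ℝ) • 1 := by
      rw [sq, sub_mul, mul_sub, mul_sub, hAB, hBA, two_smul, sq, sq]; abel
    rw [this, smul_sub, smul_smul]
    norm_num
  have hzero := hX.sq_eq_zero (S := (Real.sqrt 2)⁻¹ • (A - B)) (by
    rw [hsq, add_sub_cancel, norm_smul]
    have := (norm_add_le (A ^ 2) (B ^ 2)).trans (add_le_add (hpow hnA 2) (hpow hnB 2))
    norm_num at this ⊢
    linarith)
  rw [hsq, sub_eq_zero] at hzero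
  have hsum : B ^ 2 = (2 : ℝ) • 1 - A ^ 2 := by
    rw [← hzero, smul_smul]; norm_num
  have hA2B2 : A ^ 2 * B ^ 2 = 1 := by
    rw [sq, sq, mul_assoc, ← mul_assoc A B B, hAB, one_mul, hAB]
  rw [hsum, mul_sub, mul_smul_comm, mul_one, two_smul] at hA2B2
  -- Equivalent to `(A² - 1)² = 0`: `A²` is unipotent, so its powers grow linearly unless it is the
  -- identity.
  have hN : A ^ 2 * (A ^ 2 - 1) = A ^ 2 - 1 := by
    rw [mul_sub, mul_one, ← hA2B2]; abel
  have hlin : ∀ n : ℕ, (A ^ 2) ^ n = 1 + (n : ℝ) • (A ^ 2 - 1) := by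
    intro n
    induction n with
    | zero => simp
    | succ n ih =>
      rw [pow_succ', ih, mul_add, mul_smul_comm, hN, mul_one, Nat.cast_succ, add_smul, one_smul]
      abel
  have h0 : A ^ 2 - 1 = 0 := eq_zero_of_norm_one_add_nsmul_le fun n => by
    rw [← hlin, ← pow_mul]
    exact hpow hnA _
  have := congrArg (fun C : X →L[ℝ] X => C x) (sub_eq_zero.1 h0)
  simpa [sq, hA] using this

end ExtremelyNonComplex

/-! ### Banach–Stone arguments and rigidity on `C(K)` -/

section Isometries

variable {K : Type*} [TopologicalSpace K] [CompactSpace K]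

/-- A surjective isometry of `C(K, ℝ)` sends the constant function `1` to a unimodular function. -/
theorem isometry_map_one_mul_self (T : C(K, ℝ) ≃ₗᵢ[ℝ] C(K, ℝ)) : T 1 * T 1 = 1 := by
  have hone : ‖(1 : C(K, ℝ))‖ ≤ 1 :=
    (ContinuousMap.norm_le _ zero_le_one).2 fun x => by simp
  have hle : ∀ x, |T 1 x| ≤ 1 := fun x => by
    have := (T 1).norm_coe_le_norm x
    rw [T.norm_map] at this
    exact this.trans hone
  -- Since `|T 1| + h = 1`, both `T 1 ± h` lie in the unit ball. Pulling back by `T`, so do `1 ±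
  -- T.symm h`, and extremality of `1` kills `h`.
  set h : C(K, ℝ) := 1 - |T 1| with hh
  have hhx : ∀ x, h x = 1 - |T 1 x| := fun x => by simp [hh]
  have hadd : ‖1 + T.symm h‖ ≤ 1 := by
    rw [← T.norm_map, map_add, T.apply_symm_apply, ContinuousMap.norm_le _ zero_le_one]
    intro x
    have h1 := abs_add_le (T 1 x) (h x)
    rw [hhx, abs_of_nonneg (sub_nonneg.2 (hle x))] at h1
    simpa [hhx] using h1
  have hsub : ‖1 - T.symm h‖ ≤ 1 := by
    rw [← T.norm_map, map_sub, T.apply_symm_apply, ContinuousMap.norm_le _ zero_le_one]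
    intro x
    have h1 := abs_sub (T 1 x) (h x)
    rw [hhx, abs_of_nonneg (sub_nonneg.2 (hle x))] at h1
    simpa [hhx] using h1
  have hk : T.symm h = 0 := by
    ext x
    have h1 := abs_le.1 (((1 + T.symm h).norm_coe_le_norm x).trans hadd)
    have h2 := abs_le.1 (((1 - T.symm h).norm_coe_le_norm x).trans hsub)
    simp only [ContinuousMap.add_apply, ContinuousMap.sub_apply, ContinuousMap.one_apply] at h1 h2
    simp only [ContinuousMap.zero_apply]
    linarith [h1.2, h2.2]
  have h0 : h = 0 := by simpa using hk
  ext x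
  have hx : 1 - |T 1 x| = 0 := by rw [← hhx, h0, ContinuousMap.zero_apply]
  rw [ContinuousMap.mul_apply, ContinuousMap.one_apply, ← abs_mul_abs_self, ← sub_eq_zero.1 hx,
    one_mul]

/-- A linear isometry fixing the constant function `1` is positive. -/
theorem isometry_nonneg_of_map_one {U : C(K, ℝ) ≃ₗᵢ[ℝ] C(K, ℝ)} (hU : U 1 = 1) {f : C(K, ℝ)}
    (hf : 0 ≤ f) : 0 ≤ U f := by
  intro x
  -- Positivity is encoded as a norm inequality, which `U` preserves.
  have h1 : ‖‖f‖ • (1 : C(K, ℝ)) - f‖ ≤ ‖f‖ := by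
    refine (ContinuousMap.norm_le _ (norm_nonneg _)).2 fun y => ?_
    have h2 := (le_abs_self _).trans (f.norm_coe_le_norm y)
    have h3 : 0 ≤ f y := hf y
    simp only [ContinuousMap.sub_apply, ContinuousMap.smul_apply, ContinuousMap.one_apply,
      smul_eq_mul, mul_one, Real.norm_eq_abs]
    rw [abs_le]
    constructor <;> linarith
  have h4 := ((U (‖f‖ • (1 : C(K, ℝ)) - f)).norm_coe_le_norm x).trans_eq (U.norm_map _)
  rw [map_sub, map_smul, hU] at h4
  simp only [ContinuousMap.sub_apply, ContinuousMap.smul_apply, ContinuousMap.one_apply,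
      smul_eq_mul, mul_one, Real.norm_eq_abs] at h4
  have h5 := (abs_le.1 (h4.trans h1)).2
  exact (by linarith : (0 : ℝ) ≤ U f x)

theorem isometry_le_iff_of_map_one {U : C(K, ℝ) ≃ₗᵢ[ℝ] C(K, ℝ)} (hU : U 1 = 1) {f g : C(K, ℝ)} :
    U f ≤ U g ↔ f ≤ g := by
  have hV : U.symm 1 = 1 := by rw [LinearIsometryEquiv.symm_apply_eq, hU]
  constructor <;> intro h
  · have := isometry_nonneg_of_map_one hV (sub_nonneg.2 h)
    simpa using this
  · have := isometry_nonneg_of_map_one hU (sub_nonneg.2 h)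
    simpa using this

/-- An order isomorphism preserves suprema, and `|f| = f ⊔ -f`. -/
theorem isometry_map_abs_of_map_one {U : C(K, ℝ) ≃ₗᵢ[ℝ] C(K, ℝ)} (hU : U 1 = 1) (f : C(K, ℝ)) :
    U |f| = |U f| := by
  let e : C(K, ℝ) ≃o C(K, ℝ) :=
    { U.toLinearEquiv.toEquiv with map_rel_iff' := isometry_le_iff_of_map_one hU }
  have h : U (f ⊔ -f) = U f ⊔ U (-f) := e.map_sup f (-f)
  rw [map_neg] at h
  exact h

/-- A surjective isometry of `C(K, ℝ)` fixing the constant function `1` is a composition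
operator. -/
theorem exists_isometry_apply_eq_of_map_one {U : C(K, ℝ) ≃ₗᵢ[ℝ] C(K, ℝ)} (hU : U 1 = 1) (x : K) :
    ∃ y, ∀ f, U f x = f y := by
  by_contra! hne
  choose f hf using hne
  -- Each `g y` is nonnegative, positive at `y`, and killed by the positive unital functional `f ↦ U
  -- f x`. By compactness a finite sum of them exceeds a positive constant, yet is also killed.
  let g : K → C(K, ℝ) := fun y => |f y - U (f y) x • (1 : C(K, ℝ))|
  have hg : ∀ y z, g y z = |f y z - U (f y) x| := fun y z => by simp [g]
  have hUg : ∀ y, U (g y) x = 0 := fun y => by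
    simp [g, isometry_map_abs_of_map_one hU, hU]
  have hgpos : ∀ y, 0 < g y y := fun y => by
    rw [hg]; exact abs_pos.2 (sub_ne_zero.2 (hf y).symm)
  obtain ⟨s, hs⟩ := isCompact_univ.elim_finite_subcover (fun y => {z | 0 < g y z})
    (fun y => isOpen_lt continuous_const (g y).continuous)
    (fun y _ => Set.mem_iUnion.2 ⟨y, hgpos y⟩)
  have hpos : ∀ z, 0 < (∑ y ∈ s, g y) z := fun z => by
    obtain ⟨y, hy, hz⟩ := Set.mem_iUnion₂.1 (hs (Set.mem_univ z))
    rw [ContinuousMap.sum_apply]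
    exact Finset.sum_pos' (fun i _ => by rw [hg]; exact abs_nonneg _) ⟨y, hy, hz⟩
  obtain ⟨m, -, hm⟩ := isCompact_univ.exists_isMinOn ⟨x, Set.mem_univ x⟩
    (∑ y ∈ s, g y).continuous.continuousOn
  have hle : ((∑ y ∈ s, g y) m) • (1 : C(K, ℝ)) ≤ ∑ y ∈ s, g y := fun z => by
    simpa using hm (Set.mem_univ z)
  have h1 : U _ x ≤ U _ x := (isometry_le_iff_of_map_one hU).2 hle x
  rw [map_smul, hU, map_sum, ContinuousMap.sum_apply, ContinuousMap.sum_apply,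
    Finset.sum_eq_zero fun y _ => hUg y] at h1
  have h2 := hpos m
  rw [ContinuousMap.sum_apply] at h2
  simp only [ContinuousMap.smul_apply, ContinuousMap.one_apply, smul_eq_mul, mul_one] at h1
  linarith

theorem isometry_map_mul_of_map_one {U : C(K, ℝ) ≃ₗᵢ[ℝ] C(K, ℝ)} (hU : U 1 = 1)
    (f g : C(K, ℝ)) : U (f * g) = U f * U g := by
  ext x
  obtain ⟨y, hy⟩ := exists_isometry_apply_eq_of_map_one hU x
  simp [hy]

/-- On an extremely non-complex `C(K, ℝ)`, the only surjective isometry fixing `1` is the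
identity. -/
theorem ExtremelyNonComplex.isometry_apply_of_map_one (hK : ExtremelyNonComplex C(K, ℝ))
    {U : C(K, ℝ) ≃ₗᵢ[ℝ] C(K, ℝ)} (hU : U 1 = 1) (g : C(K, ℝ)) : U g = g := by
  -- The bound `1/2` yields `‖h‖ ≤ 1` below, hence `0 ≤ 1 - h² ≤ 1` and `‖Id + S²‖ ≤ 1`.
  wlog hg : ‖g‖ ≤ 1 / 2 generalizing g
  · have hpos : 0 < ‖g‖ := by linarith [not_le.1 hg]
    have h := this ((1 / 2 * ‖g‖⁻¹) • g) (by
      rw [norm_smul, norm_mul, norm_inv, norm_norm, mul_assoc, inv_mul_cancel₀ hpos.ne']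
      norm_num)
    rw [map_smul] at h
    exact smul_right_injective _ (by positivity : (1 / 2 * ‖g‖⁻¹) ≠ 0) h
  set h : C(K, ℝ) := g - U g with hh
  have hUh : U h = -h := by rw [hh, map_sub, hK.apply_apply_isometry, neg_sub]
  have hnorm : ‖h‖ ≤ 1 := by
    have := norm_sub_le g (U g)
    rw [U.norm_map] at this
    linarith
  let S : C(K, ℝ) →L[ℝ] C(K, ℝ) :=
    ContinuousLinearMap.mul ℝ C(K, ℝ) h * U.toLinearIsometry.toContinuousLinearMap
  have hS : ∀ f, (S ^ 2) f = -(h * h) * f := fun f => by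
    have : (S ^ 2) f = h * U (h * U f) := rfl
    rw [this, isometry_map_mul_of_map_one hU, hUh, hK.apply_apply_isometry]
    ring
  have hzero := hK.sq_eq_zero (S := S) (ContinuousLinearMap.opNorm_le_bound _ zero_le_one fun f => by
    rw [add_apply, hS, one_mul]
    refine (ContinuousMap.norm_le _ (norm_nonneg _)).2 fun x => ?_
    have h1 := abs_le.1 ((h.norm_coe_le_norm x).trans hnorm)
    have h2 : |1 - h x * h x| ≤ 1 := abs_le.2 ⟨by nlinarith, by nlinarith⟩
    have h3 : ((1 : C(K, ℝ) →L[ℝ] C(K, ℝ)) f + -(h * h) * f) x = (1 - h x * h x) * f x := by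
      simp; ring
    rw [h3, norm_mul]
    exact (mul_le_of_le_one_left (norm_nonneg _) h2).trans (f.norm_coe_le_norm x))
  have h1 := hS 1
  rw [hzero, zero_apply, mul_one, eq_comm, neg_eq_zero] at h1
  have h0 : h = 0 := by
    ext x
    have := congrArg (fun k : C(K, ℝ) => k x) h1
    simpa using this
  exact (sub_eq_zero.1 h0).symm

/-- Multiplication by a unimodular function, as a surjective isometry of `C(K, ℝ)`. -/
def mulIsometry (θ : C(K, ℝ)) (hθ : θ * θ = 1) : C(K, ℝ) ≃ₗᵢ[ℝ] C(K, ℝ) where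
  toFun f := θ * f
  invFun f := θ * f
  map_add' := mul_add θ
  map_smul' c f := mul_smul_comm c θ f
  left_inv f := show θ * (θ * f) = f by rw [← mul_assoc, hθ, one_mul]
  right_inv f := show θ * (θ * f) = f by rw [← mul_assoc, hθ, one_mul]
  norm_map' f := by
    have h1 : ∀ x, |θ x| = 1 := fun x => by
      have := congrArg (fun k : C(K, ℝ) => k x) hθ
      simp only [ContinuousMap.mul_apply, ContinuousMap.one_apply] at this
      exact (abs_eq zero_le_one).2 (mul_self_eq_one_iff.1 this)
    have h2 : ∀ x, ‖(θ * f) x‖ = ‖f x‖ := fun x => by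
      rw [ContinuousMap.mul_apply, norm_mul, Real.norm_eq_abs (θ x), h1, one_mul]
    refine le_antisymm ?_ ?_
    · exact (ContinuousMap.norm_le _ (norm_nonneg _)).2 fun x =>
        (h2 x).trans_le (f.norm_coe_le_norm x)
    · exact (ContinuousMap.norm_le _ (norm_nonneg _)).2 fun x =>
        (h2 x).symm.trans_le ((θ * f).norm_coe_le_norm x)

@[simp]
theorem mulIsometry_apply (θ : C(K, ℝ)) (hθ : θ * θ = 1) (f : C(K, ℝ)) :
    mulIsometry θ hθ f = θ * f := rfl

/-- Every surjective isometry of an extremely non-complex `C(K, ℝ)` is multiplication by its value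
at the constant function `1`. -/
theorem ExtremelyNonComplex.isometry_apply (hK : ExtremelyNonComplex C(K, ℝ))
    (T : C(K, ℝ) ≃ₗᵢ[ℝ] C(K, ℝ)) (f : C(K, ℝ)) : T f = T 1 * f := by
  have hθ := isometry_map_one_mul_self T
  -- `hθ` doubles as the statement that `f ↦ T 1 * T f` fixes `1`.
  have h : T 1 * T f = f :=
    hK.isometry_apply_of_map_one (U := T.trans (mulIsometry (T 1) hθ)) hθ f
  nth_rewrite 2 [← h]
  rw [← mul_assoc, hθ, one_mul]

end Isometries

/-! ### Indicators and signs of clopen sets -/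

section Clopens

variable {K : Type*} [TopologicalSpace K]

open Classical in
/-- The indicator function of a clopen set, as a continuous real function. -/
noncomputable def clopenIndicator (A : Clopens K) : C(K, ℝ) where
  toFun x := if x ∈ A then 1 else 0
  continuous_toFun := by
    refine continuous_if (fun x hx => ?_) continuous_const.continuousOn
      continuous_const.continuousOn
    have : frontier {x | x ∈ A} = ∅ := A.isClopen.frontier_eq
    rw [this] at hx
    exact hx.elim

theorem clopenIndicator_of_mem {A : Clopens K} {x : K} (h : x ∈ A) : clopenIndicator A x = 1 :=
  if_pos h

theorem clopenIndicator_of_notMem {A : Clopens K} {x : K} (h : x ∉ A) :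
    clopenIndicator A x = 0 :=
  if_neg h

theorem clopenIndicator_injective :
    Function.Injective (clopenIndicator : Clopens K → C(K, ℝ)) := by
  intro A B h
  ext x
  have hx := congrArg (fun k : C(K, ℝ) => k x) h
  change x ∈ A ↔ x ∈ B
  by_cases hA : x ∈ A <;> by_cases hB : x ∈ B <;>
    simp [clopenIndicator, hA, hB] at hx ⊢

theorem clopenIndicator_bot : clopenIndicator (⊥ : Clopens K) = 0 := by
  ext x
  exact clopenIndicator_of_notMem (Set.notMem_empty x)

theorem clopenIndicator_top : clopenIndicator (⊤ : Clopens K) = 1 := by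
  ext x
  exact clopenIndicator_of_mem (Set.mem_univ x)

theorem clopenIndicator_compl (A : Clopens K) :
    clopenIndicator Aᶜ = 1 - clopenIndicator A := by
  ext x
  by_cases hA : x ∈ A
  · have : x ∉ Aᶜ := fun h => h hA
    simp [clopenIndicator_of_mem hA, clopenIndicator_of_notMem this]
  · have : x ∈ Aᶜ := hA
    simp [clopenIndicator_of_mem this, clopenIndicator_of_notMem hA]

theorem clopenIndicator_inf (A B : Clopens K) :
    clopenIndicator (A ⊓ B) = clopenIndicator A * clopenIndicator B := by
  ext x
  have h : x ∈ A ⊓ B ↔ x ∈ A ∧ x ∈ B := Iff.rfl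
  by_cases hA : x ∈ A <;> by_cases hB : x ∈ B <;>
    simp [clopenIndicator, h, hA, hB]

theorem clopenIndicator_sup (A B : Clopens K) :
    clopenIndicator (A ⊔ B) =
      clopenIndicator A + clopenIndicator B - clopenIndicator A * clopenIndicator B := by
  ext x
  have h : x ∈ A ⊔ B ↔ x ∈ A ∨ x ∈ B := Iff.rfl
  by_cases hA : x ∈ A <;> by_cases hB : x ∈ B <;>
    simp [clopenIndicator, h, hA, hB]

theorem clopenIndicator_mul_self (A : Clopens K) :
    clopenIndicator A * clopenIndicator A = clopenIndicator A := by
  rw [← clopenIndicator_inf, inf_idem]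

theorem clopenIndicator_symmDiff (A B : Clopens K) :
    clopenIndicator (symmDiff A B) = clopenIndicator A + clopenIndicator B
      - 2 * (clopenIndicator A * clopenIndicator B) := by
  rw [symmDiff, sdiff_eq, sdiff_eq, clopenIndicator_sup, clopenIndicator_inf, clopenIndicator_inf,
    clopenIndicator_compl, clopenIndicator_compl]
  -- The supremum formula leaves the product of the indicators of the two disjoint differences; it
  -- vanishes by idempotence of the indicator of `A`.
  linear_combination (clopenIndicator B * (1 - clopenIndicator B)) * clopenIndicator_mul_self A

/-- The function equal to `-1` on the clopen set `A` and to `1` elsewhere. -/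
noncomputable def clopenSign (A : Clopens K) : C(K, ℝ) := 1 - (clopenIndicator A + clopenIndicator A)

theorem clopenSign_apply_of_mem {A : Clopens K} {x : K} (h : x ∈ A) : clopenSign A x = -1 := by
  norm_num [clopenSign, clopenIndicator_of_mem h]

theorem clopenSign_apply_of_notMem {A : Clopens K} {x : K} (h : x ∉ A) : clopenSign A x = 1 := by
  simp [clopenSign, clopenIndicator_of_notMem h]

theorem clopenSign_mul_self (A : Clopens K) : clopenSign A * clopenSign A = 1 := by
  rw [clopenSign]
  linear_combination 4 * clopenIndicator_mul_self A

theorem clopenSign_injective : Function.Injective (clopenSign : Clopens K → C(K, ℝ)) := by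
  intro A B h
  refine clopenIndicator_injective ?_
  ext x
  have hx := congrArg (fun k : C(K, ℝ) => k x) h
  simp only [clopenSign, ContinuousMap.sub_apply, ContinuousMap.add_apply] at hx
  linarith

theorem clopenSign_symmDiff (A B : Clopens K) :
    clopenSign (symmDiff A B) = clopenSign A * clopenSign B := by
  rw [clopenSign, clopenSign, clopenSign, clopenIndicator_symmDiff]
  ring

theorem clopenSign_compl (A : Clopens K) : clopenSign Aᶜ = -clopenSign A := by
  rw [clopenSign, clopenSign, clopenIndicator_compl]
  ring

/-- Every unimodular continuous function is the sign function of a clopen set. -/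
theorem exists_clopenSign_eq {θ : C(K, ℝ)} (hθ : θ * θ = 1) : ∃ A, clopenSign A = θ := by
  have hx : ∀ x, θ x = 1 ∨ θ x = -1 := fun x => by
    have := congrArg (fun k : C(K, ℝ) => k x) hθ
    exact mul_self_eq_one_iff.1 this
  have hset : {x | θ x < 0} = {x | θ x ≤ -1} := by
    ext x
    rcases hx x with h | h <;> norm_num [h]
  let A : Clopens K := ⟨{x | θ x < 0}, by
    rw [hset]; exact isClosed_le θ.continuous continuous_const,
    isOpen_lt θ.continuous continuous_const⟩
  refine ⟨A, ?_⟩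
  ext x
  rcases hx x with h | h
  · have hA : x ∉ A := by change ¬ θ x < 0; norm_num [h]
    rw [clopenSign_apply_of_notMem hA, h]
  · have hA : x ∈ A := by change θ x < 0; norm_num [h]
    rw [clopenSign_apply_of_mem hA, h]

end Clopens

/-! ### Clopen sets, isometries and unconditional projections -/

section Boolean

variable {K : Type*} [TopologicalSpace K] [CompactSpace K]

/-- The isometries of an extremely non-complex `C(K, ℝ)` correspond to the clopen subsets of
`K`. -/
noncomputable def clopensEquivIsometry (hK : ExtremelyNonComplex C(K, ℝ)) :
    Clopens K ≃ (C(K, ℝ) ≃ₗᵢ[ℝ] C(K, ℝ)) :=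
  Equiv.ofBijective (fun A => mulIsometry (clopenSign A) (clopenSign_mul_self A)) <| by
    constructor
    · intro A B h
      have h1 := congrArg (fun T : C(K, ℝ) ≃ₗᵢ[ℝ] C(K, ℝ) => T 1) h
      simp only [mulIsometry_apply, mul_one] at h1
      exact clopenSign_injective h1
    · intro T
      obtain ⟨A, hA⟩ := exists_clopenSign_eq (isometry_map_one_mul_self T)
      refine ⟨A, LinearIsometryEquiv.ext fun f => ?_⟩
      rw [mulIsometry_apply, hA, ← hK.isometry_apply]

theorem clopensEquivIsometry_apply (hK : ExtremelyNonComplex C(K, ℝ)) (A : Clopens K)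
    (f : C(K, ℝ)) : clopensEquivIsometry hK A f = clopenSign A * f := rfl

theorem mul_clopenIndicator_mem_unconditionalProjections (A : Clopens K) :
    ContinuousLinearMap.mul ℝ C(K, ℝ) (clopenIndicator A) ∈
      unconditionalProjections C(K, ℝ) := by
  refine ⟨?_, mulIsometry (clopenSign Aᶜ) (clopenSign_mul_self _), fun f => ?_⟩
  · refine ContinuousLinearMap.ext fun f => ?_
    change clopenIndicator A * (clopenIndicator A * f) = clopenIndicator A * f
    rw [← mul_assoc, clopenIndicator_mul_self]
  · rw [mulIsometry_apply, clopenSign_compl, clopenSign, two_smul, ContinuousLinearMap.mul_apply']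
    ring

/-- The unconditional projections of an extremely non-complex `C(K, ℝ)` correspond to the clopen
subsets of `K`. -/
noncomputable def clopensEquivUnconditionalProjections (hK : ExtremelyNonComplex C(K, ℝ)) :
    Clopens K ≃ unconditionalProjections C(K, ℝ) :=
  Equiv.ofBijective
    (fun A => ⟨ContinuousLinearMap.mul ℝ C(K, ℝ) (clopenIndicator A),
      mul_clopenIndicator_mem_unconditionalProjections A⟩) <| by
    constructor
    · intro A B h
      have h1 := congrArg (fun P : C(K, ℝ) →L[ℝ] C(K, ℝ) => P 1) (Subtype.ext_iff.1 h)
      simp only [ContinuousLinearMap.mul_apply', mul_one] at h1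
      exact clopenIndicator_injective h1
    · rintro ⟨P, -, T, hT⟩
      obtain ⟨A, hA⟩ := exists_clopenSign_eq (isometry_map_one_mul_self T)
      -- `2P - Id` is multiplication by the sign of `A`, which is `1` off `A`, so `P` is the
      -- indicator of the complement.
      refine ⟨Aᶜ, Subtype.ext <| ContinuousLinearMap.ext fun f => ?_⟩
      have h1 := hT f
      rw [hK.isometry_apply, ← hA, clopenSign] at h1
      refine smul_right_injective _ (two_ne_zero (α := ℝ)) ?_
      change (2 : ℝ) • (clopenIndicator Aᶜ * f) = (2 : ℝ) • P f
      rw [clopenIndicator_compl, eq_add_of_sub_eq h1.symm, two_smul]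
      ring

theorem clopensEquivUnconditionalProjections_coe (hK : ExtremelyNonComplex C(K, ℝ))
    (A : Clopens K) :
    (clopensEquivUnconditionalProjections hK A : C(K, ℝ) →L[ℝ] C(K, ℝ)) =
      ContinuousLinearMap.mul ℝ C(K, ℝ) (clopenIndicator A) := rfl

end Boolean

theorem mainTheorem8 {K : Type*} [TopologicalSpace K] [CompactSpace K] [T2Space K]
    [PerfectSpace K] (hK : ExtremelyNonComplex C(K, ℝ)) :
    -- every surjective linear isometry is multiplication by a continuous sign function
    (∀ T : C(K, ℝ) ≃ₗᵢ[ℝ] C(K, ℝ), ∃ θ : C(K, ({-1, 1} : Set ℝ)),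
      ∀ (f : C(K, ℝ)) (x : K), T f x = (θ x : ℝ) * f x) ∧
    -- conversely, every such multiplication is a surjective linear isometry
    (∀ θ : C(K, ({-1, 1} : Set ℝ)), ∃ T : C(K, ℝ) ≃ₗᵢ[ℝ] C(K, ℝ),
      ∀ (f : C(K, ℝ)) (x : K), T f x = (θ x : ℝ) * f x) ∧
    -- the isometry group is isomorphic to the Boolean algebra of clopen sets: as a group
    -- (with symmetric difference) through `Φ`, and with all the Boolean operations through `Ψ`,
    -- when an isometry `T` is identified with the unconditional projection `(Id - T) / 2`
    (∃ (Φ : TopologicalSpace.Clopens K ≃ (C(K, ℝ) ≃ₗᵢ[ℝ] C(K, ℝ)))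
       (Ψ : TopologicalSpace.Clopens K ≃ unconditionalProjections C(K, ℝ)),
      (∀ A B, Φ (symmDiff A B) = Φ A * Φ B) ∧
      (∀ (A : TopologicalSpace.Clopens K) (f : C(K, ℝ)) (x : K),
        (x ∈ A → Φ A f x = -f x) ∧ (x ∉ A → Φ A f x = f x)) ∧
      (∀ (A : TopologicalSpace.Clopens K) (f : C(K, ℝ)),
        Φ A f = f - (2 : ℝ) • (Ψ A : C(K, ℝ) →L[ℝ] C(K, ℝ)) f) ∧
      ((Ψ ⊥ : C(K, ℝ) →L[ℝ] C(K, ℝ)) = 0) ∧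
      ((Ψ ⊤ : C(K, ℝ) →L[ℝ] C(K, ℝ)) = 1) ∧
      (∀ A, (Ψ Aᶜ : C(K, ℝ) →L[ℝ] C(K, ℝ)) = 1 - Ψ A) ∧
      (∀ A B, (Ψ (A ⊓ B) : C(K, ℝ) →L[ℝ] C(K, ℝ)) = Ψ A * Ψ B) ∧
      (∀ A B, (Ψ (A ⊔ B) : C(K, ℝ) →L[ℝ] C(K, ℝ)) = Ψ A + Ψ B - Ψ A * Ψ B)) := by
  have hcoe : ∀ θ : C(K, ({-1, 1} : Set ℝ)), Continuous fun x => (θ x : ℝ) :=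
    fun θ => continuous_subtype_val.comp θ.continuous
  refine ⟨fun T => ?_, fun θ => ?_, clopensEquivIsometry hK,
    clopensEquivUnconditionalProjections hK, ?_, ?_, ?_, ?_, ?_, ?_, ?_, ?_⟩
  · have hmem : ∀ x, T 1 x ∈ ({-1, 1} : Set ℝ) := fun x => by
      have := congrArg (fun k : C(K, ℝ) => k x) (isometry_map_one_mul_self T)
      exact (mul_self_eq_one_iff.1 this).symm
    refine ⟨⟨fun x => ⟨T 1 x, hmem x⟩, (T 1).continuous.subtype_mk hmem⟩, fun f x => ?_⟩
    rw [hK.isometry_apply T f]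
    rfl
  · refine ⟨mulIsometry ⟨_, hcoe θ⟩ ?_, fun f x => rfl⟩
    ext x
    rcases (θ x).2 with h | h
    · simp [h]
    · simp [Set.mem_singleton_iff.1 h]
  · intro A B
    refine LinearIsometryEquiv.ext fun f => ?_
    change _ = clopensEquivIsometry hK A (clopensEquivIsometry hK B f)
    simp only [clopensEquivIsometry_apply]
    rw [clopenSign_symmDiff, mul_assoc]
  · intro A f x
    rw [clopensEquivIsometry_apply]
    refine ⟨fun h => ?_, fun h => ?_⟩
    · rw [ContinuousMap.mul_apply, clopenSign_apply_of_mem h, neg_one_mul]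
    · rw [ContinuousMap.mul_apply, clopenSign_apply_of_notMem h, one_mul]
  · intro A f
    rw [clopensEquivIsometry_apply, clopensEquivUnconditionalProjections_coe,
      ContinuousLinearMap.mul_apply', clopenSign, two_smul]
    ring
  · rw [clopensEquivUnconditionalProjections_coe, clopenIndicator_bot, map_zero]
  · rw [clopensEquivUnconditionalProjections_coe, clopenIndicator_top]
    exact ContinuousLinearMap.ext fun f => one_mul f
  · intro A
    simp only [clopensEquivUnconditionalProjections_coe]
    rw [clopenIndicator_compl, map_sub]
    congr 1
    exact ContinuousLinearMap.ext fun f => one_mul f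
  · intro A B
    simp only [clopensEquivUnconditionalProjections_coe]
    rw [clopenIndicator_inf]
    exact ContinuousLinearMap.ext fun f => mul_assoc _ _ f
  · intro A B
    simp only [clopensEquivUnconditionalProjections_coe]
    rw [clopenIndicator_sup, map_sub, map_add]
    congr 1
    exact ContinuousLinearMap.ext fun f => mul_assoc _ _ f
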